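/- Let $G$ be a finite acyclic directed mixed graph (directed edges $\to$ and bidirected edges $\leftrightarrow$, no loops, no directed cycles) with vertex set $V$. Descendants and ancestors of a vertex include the vertex itself, and $\mathrm{an}(c)$ denotes the set of ancestors of $c$; $G_W$ is the subgraph induced on $W\subseteq V$; the district of $v$ is its connected component with respect to bidirected edges; the Markov blanket of $v$ is $\mathrm{mb}(v)=\mathrm{pa}(\mathrm{dis}(v))\cup(\mathrm{dis}(v)\setminus\{v\})$, where $\mathrm{dis}(v)$ is its district and $\mathrm{pa}(D)$ is the set of all parents of vertices in $D$; and $\mathrm{mb}_W(v)$ is the Markov blanket of $v$ in $G_W$. A vertex $v$ is fixable if no descendant of $v$ other than $v$ lies in the district of $v$. A linear structural equation model associated with $G$ is given by real matrices $\Lambda=(\lambda_{xy})_{x,y\in V}$ with $\lambda_{xy}=0$ unless $x\to y$, and $\Omega=(\omega_{xy})_{x,y\in V}$ positive definite with $\omega_{xy}=0$ unless $x=y$ or $x\leftrightarrow y$; its covariance matrix is $\Sigma=(I-\Lambda)^{-T}\Omega(I-\Lambda)^{-1}$. For $S\subseteq V\setminus\{v,w\}$ put $\sigma_{vw\cdot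 S}=\sigma_{vw}-\Sigma_{vS}\Sigma_{SS}^{-1}\Sigma_{Sw}$, $\sigma_{vv\cdot S}=\sigma_{vv}-\Sigma_{vS}\Sigma_{SS}^{-1}\Sigma_{Sv}$ and $\beta_{vw\cdot S}=\sigma_{vw\cdot S}/\sigma_{vv\cdot S}$. The total directed-path effect $\sigma(\mathcal D_{bc})$ is the sum, over all directed paths from $b$ to $c$, of the product of the coefficients $\lambda_{xy}$ of the edges $x\to y$ of the path. It is called regression identifiable if there is a set $S\subseteq V\setminus\{b,c\}$ such that $\sigma(\mathcal D_{bc})=\beta_{bc\cdot S}$ for every linear structural equation model associated with $G$. Theorem. Let $b\in V$ and let $c\neq b$ be a descendant of $b$. Then $\sigma(\mathcal D_{bc})$ is regression identifiable if and only if $b$ is fixable in $G_{\mathrm{an}(c)}$. In that case $S(c):=\mathrm{mb}_{\mathrm{an}(c)}(b)$ contains neither $b$ nor $c$, and $\sigma(\mathcal D_{bc})=\beta_{bc\cdot S(c)}$ for every linear structural equation model associated with $G$. -/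

import Mathlib

open Matrix

/-- An acyclic directed mixed graph with vertex set `V`: directed edges `x → y` (`dir x y`) and
bidirected edges `x ↔ y` (`bi.Adj x y`), without loops and without directed cycles.  A directed
and a bidirected edge may join the same two vertices. -/
structure ADMG (V : Type*) where
  dir : V → V → Prop
  bi : SimpleGraph V
  acyclic : ∀ v, ¬ Relation.TransGen dir v v

namespace ADMG

variable {V : Type*}

/-- The set of parents of the vertices in `S`. -/
def pa (G : ADMG V) (S : Set V) : Set V := {x | ∃ y ∈ S, G.dir x y}

/-- The ancestors of `v` (including `v`). -/
def an (G : ADMG V) (v : V) : Set V := {x | Relation.ReflTransGen G.dir x v}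

/-- The descendants of `v` (including `v`). -/
def de (G : ADMG V) (v : V) : Set V := {x | Relation.ReflTransGen G.dir v x}

theorem mem_an_of_mem_de (G : ADMG V) {b c : V} (h : c ∈ G.de b) : b ∈ G.an c := h

/-- The district of `v`: its connected component with respect to the bidirected edges. -/
def dis (G : ADMG V) (v : V) : Set V := {x | G.bi.Reachable v x}

/-- The Markov blanket of `v`. -/
def mb (G : ADMG V) (v : V) : Set V := G.pa (G.dis v) ∪ (G.dis v \ {v})

/-- `v` is fixable if no descendant of `v` other than `v` lies in the district of `v`. -/
def Fixable (G : ADMG V) (v : V) : Prop := G.de v ∩ G.dis v = {v}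

/-- The induced subgraph `G_W`, with vertex set `W`. -/
def induce (G : ADMG V) (W : Set V) : ADMG W where
  dir x y := G.dir x y
  bi := G.bi.induce W
  acyclic v h := G.acyclic v (h.lift (fun x : W => (x : V)) fun _ _ hxy => hxy)

/-- The Markov blanket `mb_W(v)` of `v ∈ W` in `G_W`, as a set of vertices of `G`. -/
def mbIn (G : ADMG V) (W : Set V) (v : W) : Set V := Subtype.val '' (G.induce W).mb v

/-- The directed paths `b = v₀ → v₁ → ⋯ → v_ℓ = c` with distinct vertices, as lists
`[v₀, …, v_ℓ]`. -/
def directedPaths (G : ADMG V) (b c : V) : Set (List V) :=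
  {l | l.Nodup ∧ l.IsChain G.dir ∧ l.head? = some b ∧ l.getLast? = some c}

theorem directedPaths_finite [Fintype V] (G : ADMG V) (b c : V) :
    (G.directedPaths b c).Finite := by
  classical
  have h : {l : List V | l.Nodup}.Finite :=
    Set.finite_coe_iff.mp (inferInstanceAs (Finite {l : List V // l.Nodup}))
  exact h.subset fun l hl => hl.1

/-- The parameters of a (Gaussian) linear structural equation model
`X = Λᵀ X + ε`, `Cov ε = Ω`, associated with `G`: the edge coefficient `Λ x y` can be nonzero only
if `x → y`, and the positive definite error covariance matrix `Ω` can have a nonzero off-diagonal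
entry `Ω x y` only if `x ↔ y`. -/
structure LinearSEM [Fintype V] (G : ADMG V) where
  Λ : Matrix V V ℝ
  Ω : Matrix V V ℝ
  Λ_eq_zero : ∀ x y, ¬ G.dir x y → Λ x y = 0
  Ω_eq_zero : ∀ x y, x ≠ y → ¬ G.bi.Adj x y → Ω x y = 0
  Ω_posDef : Ω.PosDef

end ADMG

section Regression

variable {V : Type*} [DecidableEq V]

/-- `σ_{vw·S} = σ_{vw} - Σ_{vS} Σ_{SS}⁻¹ Σ_{Sw}`. -/
noncomputable def partialCov (Sig : Matrix V V ℝ) (v w : V) (S : Finset V) : ℝ :=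
  Sig v w - (fun s : S => Sig v s) ⬝ᵥ
    ((Sig.submatrix (Subtype.val : S → V) Subtype.val)⁻¹ *ᵥ fun s : S => Sig s w)

/-- The regression coefficient `β_{vw·S} = σ_{vw·S} / σ_{vv·S}`. -/
noncomputable def regCoeff (Sig : Matrix V V ℝ) (v w : V) (S : Finset V) : ℝ :=
  partialCov Sig v w S / partialCov Sig v v S

end Regression

namespace ADMG

variable {V : Type*} [Fintype V] [DecidableEq V] {G : ADMG V}

/-- The covariance matrix `Σ = (I - Λ)⁻ᵀ Ω (I - Λ)⁻¹` of `X`. -/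
noncomputable def LinearSEM.cov (M : G.LinearSEM) : Matrix V V ℝ :=
  ((1 - M.Λ)⁻¹)ᵀ * M.Ω * (1 - M.Λ)⁻¹

/-- The product of the edge coefficients along the directed path `v₀ → v₁ → ⋯ → v_ℓ` given by the
list `[v₀, …, v_ℓ]`. -/
noncomputable def LinearSEM.pathCoeff (M : G.LinearSEM) (l : List V) : ℝ :=
  (List.zipWith (fun x y => M.Λ x y) l l.tail).prod

/-- The total directed-path effect `σ(𝒟_{bc})`: the sum over all directed paths from `b` to `c` of
the products of the edge coefficients. -/
noncomputable def LinearSEM.pathEffect (M : G.LinearSEM) (b c : V) : ℝ :=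
  ∑ l ∈ (G.directedPaths_finite b c).toFinset, M.pathCoeff l

/-- `σ(𝒟_{bc})` is identified by regression with the adjustment set `S ⊆ V \ {b, c}`: the identity
`σ(𝒟_{bc}) = β_{bc·S}` holds in every linear structural equation model associated with `G`. -/
def IdentifiedByRegression (G : ADMG V) (b c : V) (S : Finset V) : Prop :=
  b ∉ S ∧ c ∉ S ∧ ∀ M : G.LinearSEM, M.pathEffect b c = regCoeff M.cov b c S

/-- `σ(𝒟_{bc})` is regression identifiable. -/
def RegressionIdentifiable (G : ADMG V) (b c : V) : Prop :=
  ∃ S : Finset V, G.IdentifiedByRegression b c S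

end ADMG

/-! Write `T = (1 - Λ)⁻¹`; acyclicity makes `T b c` the directed-path effect. If `u` is the residual
vector (`u b = 1`, supported on `{b} ∪ S`, `Σ u = 0` on `S`), then `β_{bc·S} = (Σ u) c / (Σ u) b`,
so identification by `S` means `(Σ u) c = T b c * (Σ u) b`, with `Σ u = Tᵀ Ω T u`.

Sufficiency (`Fixable.exists_isResidual`): regress the error of `b` on the other errors of its
district in `G_{an(c)}`, with residual vector `η`. Then `Ω η` vanishes on `an(c)` except at `b`, and
`u = (1 - Λ) η` is supported on `b` and its Markov blanket. Hence `(Σ u) w = T b w * κ` on `an(c)`.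
Fixability keeps descendants of `b` out of the blanket, so this vanishes there and `u` is the
residual vector.

Necessity: suppose `S` works but some `d ≠ b` is a descendant of `b` in its district in `G_{an(c)}`.
By `IdentifiedByRegression.not_reflTransGen`, tested on a model with one very noisy child of `b`, no
descendant of `d` lies in `S`. In `IdentifiedByRegression.false_of_bidirected_path` every error then
flows to a single vertex of `{b, c} ∪ S`, that of `d` to `c` and that of `b` nowhere. The bidirected
path from `b` to `d` becomes a path from `b` to `c` in the support of `Σ`, while `T b c = 0`.
Solving the regression equations along it from `c` back to `b` forces `u b = 0`. -/

theorem Matrix.PosDef.apply_comm {V : Type*} {Sig : Matrix V V ℝ} (h : Sig.PosDef) (v w : V) : Sig v w = Sig w v := by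
  simpa using h.isHermitian.apply w v

theorem Matrix.PosDef.isUnit_det_submatrix {V : Type*} [DecidableEq V] {Sig : Matrix V V ℝ}
    (h : Sig.PosDef) (S : Finset V) :
    IsUnit (Sig.submatrix (Subtype.val : S → V) Subtype.val).det :=
  (Matrix.isUnit_iff_isUnit_det _).1 (h.submatrix Subtype.val_injective).isUnit

/-! ### Regression coefficients through residual vectors -/

section Regression

variable {V : Type*} [Fintype V] [DecidableEq V]

/-- `u` is the coefficient vector of a residual of `X_b` regressed on `X_S`, when `X` has
covariance matrix `Sig`. -/
structure IsResidual (Sig : Matrix V V ℝ) (b : V) (S : Finset V) (u : V → ℝ) : Prop where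
  apply_self : u b = 1
  apply_eq_zero : ∀ v, v ≠ b → v ∉ S → u v = 0
  mulVec_eq_zero : ∀ s ∈ S, (Sig *ᵥ u) s = 0

theorem sum_eq_add_sum_of_support {b : V} {S : Finset V} (hb : b ∉ S) {f : V → ℝ}
    (hf : ∀ v, v ≠ b → v ∉ S → f v = 0) : ∑ v, f v = f b + ∑ s : S, f s := by
  rw [Finset.sum_coe_sort S f, ← Finset.sum_insert hb]
  refine (Finset.sum_subset (Finset.subset_univ _) fun v _ hv => ?_).symm
  rw [Finset.mem_insert, not_or] at hv
  exact hf v hv.1 hv.2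

theorem mulVec_apply_of_support {Sig : Matrix V V ℝ} {b : V} {S : Finset V} (hb : b ∉ S)
    {u : V → ℝ} (hu1 : u b = 1) (hu : ∀ v, v ≠ b → v ∉ S → u v = 0) (w : V) :
    (Sig *ᵥ u) w = Sig w b + ∑ s : S, Sig w s * u s := by
  rw [mulVec, dotProduct, sum_eq_add_sum_of_support hb fun v h1 h2 => by simp [hu v h1 h2]]
  simp [hu1]

namespace Matrix.PosDef

variable {Sig : Matrix V V ℝ} {b : V} {S : Finset V}

theorem exists_isResidual (h : Sig.PosDef) (hb : b ∉ S) : ∃ u, IsResidual Sig b S u := by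
  set A := Sig.submatrix (Subtype.val : S → V) Subtype.val with hA
  set g : S → ℝ := A⁻¹ *ᵥ fun s : S => Sig s b with hg
  have hAg : A *ᵥ g = fun s : S => Sig s b := by
    rw [hg, mulVec_mulVec, mul_nonsing_inv _ (h.isUnit_det_submatrix S), one_mulVec]
  let u : V → ℝ := fun v => if v = b then 1 else if hv : v ∈ S then -g ⟨v, hv⟩ else 0
  have h1 : u b = 1 := by simp [u]
  have h2 : ∀ v, v ≠ b → v ∉ S → u v = 0 := fun v hv hv' => by simp [u, hv, hv']
  refine ⟨u, h1, h2, fun s hs => ?_⟩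
  rw [mulVec_apply_of_support hb h1 h2]
  have h3 : ∀ t : S, u t = -g t := fun t => by
    have : (t : V) ≠ b := fun e => hb (e ▸ t.2)
    simp [u, this]
  have := congrFun hAg ⟨s, hs⟩
  simp only [mulVec, dotProduct, hA, submatrix_apply] at this
  simp only [h3, mul_neg, Finset.sum_neg_distrib, this, add_neg_cancel]

/-- The equations `Σ u = 0` on `S` say that `u` restricted to `S` is `-Σ_{SS}⁻¹ Σ_{Sb}`, so the
correction term of the partial covariance is already contained in `Σ u`. -/
theorem partialCov_eq (h : Sig.PosDef) (hb : b ∉ S) {u : V → ℝ} (hu : IsResidual Sig b S u)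
    (w : V) : partialCov Sig b w S = (Sig *ᵥ u) w := by
  set A := Sig.submatrix (Subtype.val : S → V) Subtype.val with hA
  have hAt : Aᵀ = A := by
    ext i j
    exact h.apply_comm _ _
  have h1 : A *ᵥ (fun s : S => u s) = fun s : S => -Sig s b := by
    ext s
    have := hu.mulVec_eq_zero s s.2
    rw [mulVec_apply_of_support hb hu.apply_self hu.apply_eq_zero] at this
    simp only [mulVec, dotProduct, hA, submatrix_apply]
    linarith
  have h2 : (fun s : S => Sig b s) ᵥ* A⁻¹ = fun s : S => -u s := by
    have : A⁻¹ *ᵥ (A *ᵥ fun s : S => u s) = fun s : S => u s := by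
      rw [mulVec_mulVec, nonsing_inv_mul _ (h.isUnit_det_submatrix S), one_mulVec]
    rw [← mulVec_transpose, transpose_nonsing_inv, hAt]
    have h3 : (fun s : S => Sig b s) = -(A *ᵥ fun s : S => u s) := by
      rw [h1]
      ext s
      simp [h.apply_comm b s]
    rw [h3, mulVec_neg, this]
    rfl
  rw [partialCov, dotProduct_mulVec, h2, mulVec_apply_of_support hb hu.apply_self hu.apply_eq_zero,
    dotProduct, h.apply_comm b w, sub_eq_add_neg, ← Finset.sum_neg_distrib]
  congr 1
  refine Finset.sum_congr rfl fun s _ => ?_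
  rw [h.apply_comm w s]
  ring

/-- This entry is the residual variance: all other terms of `u ⬝ᵥ Σ u` vanish. -/
theorem mulVec_residual_pos (h : Sig.PosDef) {u : V → ℝ} (hu : IsResidual Sig b S u) :
    0 < (Sig *ᵥ u) b := by
  have hne : u ≠ 0 := fun e => by simpa [e] using hu.apply_self
  have := h.dotProduct_mulVec_pos hne
  rw [star_trivial, dotProduct, Finset.sum_eq_single b] at this
  · simpa [hu.apply_self] using this
  · intro v _ hv
    by_cases hS : v ∈ S
    · simp [hu.mulVec_eq_zero v hS]
    · simp [hu.apply_eq_zero v hv hS]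
  · simp

theorem regCoeff_eq (h : Sig.PosDef) (hb : b ∉ S) {u : V → ℝ} (hu : IsResidual Sig b S u)
    (w : V) : regCoeff Sig b w S = (Sig *ᵥ u) w / (Sig *ᵥ u) b := by
  rw [regCoeff, h.partialCov_eq hb hu, h.partialCov_eq hb hu]

end Matrix.PosDef

end Regression

/-! ### Total effects and sums over directed paths -/

namespace ADMG

variable {V : Type*} {G : ADMG V}

/-- Split off the first edge. Acyclicity guarantees that prepending an edge never repeats a vertex.
-/
theorem directedPaths_eq (G : ADMG V) (x y : V) :
    G.directedPaths x y = {l | x = y ∧ l = [x]} ∪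
      ⋃ w ∈ {w | G.dir x w}, List.cons x '' G.directedPaths w y := by
  ext l
  simp only [Set.mem_union, Set.mem_iUnion, Set.mem_image, Set.mem_ofPred_eq, directedPaths,
    exists_prop]
  constructor
  · rintro ⟨hn, hc, hh, hl⟩
    match l, hn, hc, hh, hl with
    | [a], hn, hc, hh, hl =>
      simp only [List.head?_cons, List.getLast?_singleton, Option.some.injEq] at hh hl
      exact .inl ⟨hh ▸ hl, by rw [hh]⟩
    | a :: w :: l, hn, hc, hh, hl =>
      simp only [List.head?_cons, Option.some.injEq] at hh
      subst hh
      rw [List.isChain_cons_cons] at hc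
      exact .inr ⟨w, hc.1, w :: l, ⟨hn.of_cons, hc.2, rfl, by simpa using hl⟩, rfl⟩
  · rintro (⟨rfl, rfl⟩ | ⟨w, hw, l, ⟨hn, hc, hh, hl⟩, rfl⟩)
    · simp
    · match l, hn, hc, hh, hl with
      | a :: l, hn, hc, hh, hl =>
        simp only [List.head?_cons, Option.some.injEq] at hh
        subst hh
        refine ⟨List.nodup_cons.2 ⟨fun hx => ?_, hn⟩, List.isChain_cons_cons.2 ⟨hw, hc⟩, rfl,
          by simpa using hl⟩
        have h2 : ∀ z ∈ a :: l, Relation.ReflTransGen G.dir a z := by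
          have h3 := List.isChain_iff_pairwise.1
            (hc.imp fun _ _ h => Relation.ReflTransGen.single (r := G.dir) h)
          intro z hz
          rcases List.mem_cons.1 hz with rfl | hz
          · exact .refl
          · exact (List.pairwise_cons.1 h3).1 z hz
        exact G.acyclic x (.head' hw (h2 x hx))

variable [Fintype V]

theorem wellFounded_swap_dir (G : ADMG V) : WellFounded (Function.swap G.dir) := by
  have : IsTrans V (Function.swap (Relation.TransGen G.dir)) := ⟨fun _ _ _ h h' => h'.trans h⟩
  have : Std.Irrefl (Function.swap (Relation.TransGen G.dir)) := ⟨G.acyclic⟩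
  exact Subrelation.wf (r := Function.swap (Relation.TransGen G.dir)) (fun h => Relation.TransGen.single h)
    (Finite.wellFounded_of_trans_of_irrefl (Function.swap (Relation.TransGen G.dir)))

theorem LinearSEM.pathCoeff_cons (M : G.LinearSEM) {w y : V} {l : List V} (x : V) (hl : l ∈ G.directedPaths w y) :
    M.pathCoeff (x :: l) = M.Λ x w * M.pathCoeff l := by
  match l, hl.2.2.1 with
  | a :: l, hh =>
    simp only [List.head?_cons, Option.some.injEq] at hh
    subst hh
    simp [pathCoeff]

theorem LinearSEM.pathEffect_eq_finsum (M : G.LinearSEM) (x y : V) :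
    M.pathEffect x y = ∑ᶠ l ∈ G.directedPaths x y, M.pathCoeff l :=
  (finsum_mem_eq_finite_toFinset_sum _ (G.directedPaths_finite x y)).symm

variable [DecidableEq V]

namespace LinearSEM

variable (M : G.LinearSEM)

/-- A kernel vector vanishes at each vertex once it vanishes at all children, so induction from the
sinks upwards kills it. -/
theorem isUnit_det : IsUnit (1 - M.Λ).det := by
  rw [← Matrix.isUnit_iff_isUnit_det, ← mulVec_injective_iff_isUnit]
  refine (injective_iff_map_eq_zero (1 - M.Λ).mulVecLin).2 fun t ht => funext fun x => ?_
  simp only [mulVecLin_apply, sub_mulVec, one_mulVec, sub_eq_zero] at ht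
  induction x using G.wellFounded_swap_dir.induction with
  | _ x ih =>
    rw [ht, mulVec, dotProduct]
    refine Finset.sum_eq_zero fun y _ => ?_
    by_cases hxy : G.dir x y
    · rw [ih y hxy, Pi.zero_apply, mul_zero]
    · rw [M.Λ_eq_zero x y hxy, zero_mul]

/-- The matrix of total effects: `X = Tᵀ ε`. -/
noncomputable def totalEffect : Matrix V V ℝ := (1 - M.Λ)⁻¹

theorem mul_totalEffect : (1 - M.Λ) * M.totalEffect = 1 := mul_nonsing_inv _ M.isUnit_det

theorem totalEffect_mul : M.totalEffect * (1 - M.Λ) = 1 := nonsing_inv_mul _ M.isUnit_det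

theorem totalEffect_apply (x y : V) :
    M.totalEffect x y = (1 : Matrix V V ℝ) x y + ∑ w, M.Λ x w * M.totalEffect w y := by
  have := congrFun₂ M.mul_totalEffect x y
  rw [sub_mul, one_mul, Matrix.sub_apply, mul_apply] at this
  linarith

theorem totalEffect_apply' (x y : V) :
    M.totalEffect x y = (1 : Matrix V V ℝ) x y + ∑ w, M.totalEffect x w * M.Λ w y := by
  have := congrFun₂ M.totalEffect_mul x y
  rw [mul_sub, mul_one, Matrix.sub_apply, mul_apply] at this
  linarith

/-- The column of total effects on `y` is determined by first-step decomposition. -/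
theorem eq_totalEffect {t : V → ℝ} {y : V}
    (ht : ∀ x, t x = (1 : Matrix V V ℝ) x y + ∑ w, M.Λ x w * t w) (x : V) :
    t x = M.totalEffect x y := by
  have h : (1 - M.Λ) *ᵥ t = fun x => (1 : Matrix V V ℝ) x y := by
    ext x
    rw [sub_mulVec, one_mulVec, Pi.sub_apply, ht x]
    simp [mulVec, dotProduct]
  have h2 := congrArg (M.totalEffect *ᵥ ·) h
  simp only [mulVec_mulVec, totalEffect_mul, one_mulVec] at h2
  rw [h2]
  simp [mulVec, dotProduct, one_apply]

theorem totalEffect_eq_zero {x y : V} (h : ¬ Relation.ReflTransGen G.dir x y) :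
    M.totalEffect x y = 0 := by
  induction x using G.wellFounded_swap_dir.induction with
  | _ x ih =>
    have hne : x ≠ y := fun e => h (e ▸ .refl)
    rw [totalEffect_apply, one_apply_ne hne, zero_add]
    refine Finset.sum_eq_zero fun w _ => ?_
    by_cases hxw : G.dir x w
    · rw [ih w hxw fun hw => h (.head hxw hw), mul_zero]
    · rw [M.Λ_eq_zero x w hxw, zero_mul]

theorem totalEffect_self (x : V) : M.totalEffect x x = 1 := by
  rw [totalEffect_apply, one_apply_eq, add_eq_left]
  refine Finset.sum_eq_zero fun w _ => ?_
  by_cases hxw : G.dir x w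
  · rw [M.totalEffect_eq_zero fun hw => G.acyclic x (.head' hxw hw), mul_zero]
  · rw [M.Λ_eq_zero x w hxw, zero_mul]

theorem totalEffect_nonneg (hΛ : ∀ x y, 0 ≤ M.Λ x y) (x y : V) : 0 ≤ M.totalEffect x y := by
  induction x using G.wellFounded_swap_dir.induction with
  | _ x ih =>
    rw [totalEffect_apply]
    refine add_nonneg (by rw [one_apply]; split <;> norm_num) (Finset.sum_nonneg fun w _ => ?_)
    by_cases hxw : G.dir x w
    · exact mul_nonneg (hΛ x w) (ih w hxw)
    · rw [M.Λ_eq_zero x w hxw, zero_mul]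

theorem cov_eq : M.cov = M.totalEffectᵀ * M.Ω * M.totalEffect := rfl

theorem cov_mulVec (u : V → ℝ) :
    M.cov *ᵥ u = M.totalEffectᵀ *ᵥ (M.Ω *ᵥ (M.totalEffect *ᵥ u)) := by
  rw [cov_eq, mulVec_mulVec, mulVec_mulVec, Matrix.mul_assoc]

theorem cov_posDef : M.cov.PosDef := by
  have := M.Ω_posDef.conjTranspose_mul_mul_same (B := M.totalEffect)
    (mulVec_injective_iff_isUnit.2 ((Matrix.isUnit_iff_isUnit_det _).2
      (isUnit_nonsing_inv_det _ M.isUnit_det)))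
  rwa [conjTranspose_eq_transpose_of_trivial] at this

end LinearSEM

namespace LinearSEM

variable (M : G.LinearSEM)

/-- Path sums obey the first-step recursion that determines the columns of `T` uniquely. -/
theorem pathEffect_apply (x y : V) :
    M.pathEffect x y = (1 : Matrix V V ℝ) x y + ∑ w, M.Λ x w * M.pathEffect w y := by
  have hfin : ∀ w, (List.cons x '' G.directedPaths w y).Finite := fun w =>
    (G.directedPaths_finite w y).image _
  have h1 : ∑ᶠ l ∈ {l : List V | x = y ∧ l = [x]}, M.pathCoeff l = (1 : Matrix V V ℝ) x y := by
    by_cases hxy : x = y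
    · subst hxy
      simp [pathCoeff]
    · simp [hxy]
  have h2 : ∀ w ∈ {w | G.dir x w}, ∑ᶠ l ∈ List.cons x '' G.directedPaths w y, M.pathCoeff l =
      M.Λ x w * M.pathEffect w y := fun w hw => by
    rw [finsum_mem_image (List.cons_injective.injOn), pathEffect_eq_finsum,
      mul_finsum_mem]
    exact finsum_mem_congr rfl fun l hl => M.pathCoeff_cons x hl
  rw [pathEffect_eq_finsum, directedPaths_eq, finsum_mem_union, h1, finsum_mem_biUnion]
  · congr 1
    rw [finsum_mem_congr rfl h2, ← finsum_eq_sum_of_fintype]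
    refine finsum_congr fun w => ?_
    by_cases hw : G.dir x w
    · simp [hw]
    · simp [hw, M.Λ_eq_zero x w hw]
  · rintro w - w' - hne
    refine Set.disjoint_left.2 ?_
    rintro _ ⟨l, hl, rfl⟩ ⟨l', hl', h⟩
    obtain rfl := (List.cons.inj h).2
    exact hne (Option.some_injective _ (hl.2.2.1.symm.trans hl'.2.2.1))
  · exact Set.toFinite _
  · exact fun w _ => hfin w
  · refine Set.disjoint_left.2 ?_
    rintro _ ⟨-, rfl⟩ h
    simp only [Set.mem_iUnion] at h
    obtain ⟨w, hw, l, hl, h⟩ := h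
    obtain rfl := (List.cons.inj h).2
    simpa using hl.2.2.1
  · exact (Set.finite_singleton [x]).subset fun l hl => hl.2
  · exact (Set.toFinite _).biUnion fun w _ => hfin w

theorem pathEffect_eq_totalEffect (x y : V) : M.pathEffect x y = M.totalEffect x y :=
  M.eq_totalEffect (fun x => M.pathEffect_apply x y) x

end LinearSEM

/-- Regression with adjustment set `S` gives the total effect, in terms of the residual of
`X_b` regressed on `X_S`. -/
theorem IdentifiedByRegression.cov_mulVec_eq {b c : V} {S : Finset V}
    (h : G.IdentifiedByRegression b c S) (M : G.LinearSEM) {u : V → ℝ}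
    (hu : IsResidual M.cov b S u) :
    (M.cov *ᵥ u) c = M.totalEffect b c * (M.cov *ᵥ u) b := by
  have h1 := h.2.2 M
  rwa [M.pathEffect_eq_totalEffect, M.cov_posDef.regCoeff_eq h.1 hu,
    eq_div_iff (M.cov_posDef.mulVec_residual_pos hu).ne', eq_comm] at h1

end ADMG

/-! ### Sufficiency: the Markov blanket as adjustment set -/

namespace ADMG

variable {V : Type*}

theorem reflTransGen_induce_an (G : ADMG V) {c x y : V} (h : Relation.ReflTransGen G.dir x y)
    (hy : y ∈ G.an c) :
    ∃ hx : x ∈ G.an c, Relation.ReflTransGen (G.induce (G.an c)).dir ⟨x, hx⟩ ⟨y, hy⟩ := by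
  induction h using Relation.ReflTransGen.head_induction_on with
  | refl => exact ⟨hy, .refl⟩
  | head h h' ih =>
    obtain ⟨hx, ih⟩ := ih
    exact ⟨.head h hx, .head (by exact h) ih⟩

theorem mem_de_induce_an (G : ADMG V) {c : V} (x y : G.an c) :
    y ∈ (G.induce (G.an c)).de x ↔ Relation.ReflTransGen G.dir x y :=
  ⟨fun h => h.lift (fun v : G.an c => (v : V)) fun _ _ h => h,
    fun h => (G.reflTransGen_induce_an h y.2).2⟩

theorem mem_mbIn (G : ADMG V) {W : Set V} {v : W} {x : V} :
    x ∈ G.mbIn W v ↔ x ∈ W ∧ (∃ y ∈ (G.induce W).dis v, G.dir x y) ∨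
      ∃ h : x ∈ W, ⟨x, h⟩ ∈ (G.induce W).dis v ∧ x ≠ v := by
  constructor
  · rintro ⟨y, ⟨z, hz, hyz⟩ | ⟨hy, hne⟩, rfl⟩
    · exact .inl ⟨y.2, z, hz, hyz⟩
    · exact .inr ⟨y.2, hy, fun h => hne (Subtype.ext h)⟩
  · rintro (⟨hx, z, hz, hxz⟩ | ⟨hx, hd, hne⟩)
    · exact ⟨⟨x, hx⟩, .inl ⟨z, hz, hxz⟩, rfl⟩
    · exact ⟨⟨x, hx⟩, .inr ⟨hd, fun h => hne (congrArg Subtype.val h)⟩, rfl⟩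

section Fixable

variable {G : ADMG V} {c : V} {b : G.an c}

theorem Fixable.eq_of_reflTransGen (hf : (G.induce (G.an c)).Fixable b) {d : G.an c}
    (hd : d ∈ (G.induce (G.an c)).dis b) (h : Relation.ReflTransGen G.dir b d) : d = b := by
  have : d ∈ ({b} : Set (G.an c)) := hf ▸ ⟨(G.mem_de_induce_an b d).2 h, hd⟩
  exact this

/-- A blanket vertex below `b` would put a district vertex below `b`. By fixability that vertex is
`b`, which gives a directed cycle or contradicts the exclusion of `b`. -/
theorem Fixable.not_reflTransGen_of_mem_mbIn (hf : (G.induce (G.an c)).Fixable b) {x : V}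
    (hx : x ∈ G.mbIn (G.an c) b) : ¬ Relation.ReflTransGen G.dir b x := by
  intro h
  obtain ⟨-, d, hd, hxd⟩ | ⟨hxA, hd, hne⟩ := G.mem_mbIn.1 hx
  · have := hf.eq_of_reflTransGen hd (h.tail hxd)
    exact G.acyclic b (.tail' h (this ▸ hxd))
  · exact hne (congrArg Subtype.val (hf.eq_of_reflTransGen hd h))

variable [Fintype V] [DecidableEq V]

theorem Fixable.exists_isResidual (hf : (G.induce (G.an c)).Fixable b) {S : Finset V}
    (hS : ∀ x, x ∈ S ↔ x ∈ G.mbIn (G.an c) b) (M : G.LinearSEM) :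
    ∃ u κ, IsResidual M.cov b S u ∧ ∀ w ∈ G.an c, (M.cov *ᵥ u) w = M.totalEffect b w * κ := by
  classical
  let D : Finset V := {x | (∃ h : x ∈ G.an c, ⟨x, h⟩ ∈ (G.induce (G.an c)).dis b) ∧ x ≠ b}
  have hD : ∀ x, x ∈ D ↔ ∃ h : x ∈ G.an c, ⟨x, h⟩ ∈ (G.induce (G.an c)).dis b ∧ x ≠ b := by
    intro x
    simp [D, exists_and_right]
  have hbD : (b : V) ∉ D := fun h => ((hD b).1 h).2.2 rfl
  obtain ⟨η, hη⟩ := M.Ω_posDef.exists_isResidual hbD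
  have hη0 : ∀ x, η x ≠ 0 → ∃ h : x ∈ G.an c, ⟨x, h⟩ ∈ (G.induce (G.an c)).dis b := by
    intro x hx
    by_cases hxb : x = b
    · subst hxb
      exact ⟨b.2, SimpleGraph.Reachable.refl _⟩
    · have : x ∈ D := by
        by_contra h
        exact hx (hη.apply_eq_zero x hxb h)
      obtain ⟨h, h', -⟩ := (hD x).1 this
      exact ⟨h, h'⟩
  -- Inside the district this is the residual equation; elsewhere in `an(c)`, `Ω` has no entry
  -- joining `x` to the district of `b`.
  have hΩη : ∀ x ∈ G.an c, x ≠ b → (M.Ω *ᵥ η) x = 0 := by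
    intro x hx hxb
    by_cases hxD : x ∈ D
    · exact hη.mulVec_eq_zero x hxD
    · refine Finset.sum_eq_zero fun y _ => ?_
      by_cases hy : η y = 0
      · simp [hy]
      · obtain ⟨hyA, hyd⟩ := hη0 y hy
        have hxd : ⟨x, hx⟩ ∉ (G.induce (G.an c)).dis b := fun h => hxD ((hD x).2 ⟨hx, h, hxb⟩)
        have h0 : M.Ω x y = 0 := by
          refine M.Ω_eq_zero x y (fun e => ?_) fun h => ?_
          · subst e
            exact hxd hyd
          · exact hxd (SimpleGraph.Reachable.trans hyd
            (SimpleGraph.Adj.reachable (G := G.bi.induce (G.an c)) (u := ⟨y, hyA⟩) (v := ⟨x, hx⟩)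
              (by simpa using h.symm)))
        exact mul_eq_zero_of_left h0 _
  -- Chosen so that `T u = η`. Only ancestors of `w ∈ an(c)` contribute to `(Σ u) w`, and among them
  -- `Ω η` survives only at `b`.
  refine ⟨(1 - M.Λ) *ᵥ η, (M.Ω *ᵥ η) b, ?_⟩
  have hmain : ∀ w ∈ G.an c, (M.cov *ᵥ ((1 - M.Λ) *ᵥ η)) w =
      M.totalEffect b w * (M.Ω *ᵥ η) b := by
    intro w hw
    rw [M.cov_mulVec, mulVec_mulVec η, M.totalEffect_mul, one_mulVec, mulVec, dotProduct,
      Finset.sum_eq_single (b : V)]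
    · rfl
    · intro x _ hxb
      rw [transpose_apply]
      by_cases hxw : Relation.ReflTransGen G.dir x w
      · rw [hΩη x (hxw.trans hw) hxb, mul_zero]
      · rw [M.totalEffect_eq_zero hxw, zero_mul]
    · simp
  have hmul : ∀ v, ((1 - M.Λ) *ᵥ η) v = η v - ∑ w, M.Λ v w * η w := by
    intro v
    rw [sub_mulVec, one_mulVec]
    rfl
  refine ⟨⟨?_, ?_, ?_⟩, hmain⟩
  · rw [hmul, hη.apply_self, sub_eq_self]
    refine Finset.sum_eq_zero fun w _ => ?_
    by_cases hw : η w = 0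
    · rw [hw, mul_zero]
    · obtain ⟨hwA, hwd⟩ := hη0 w hw
      rw [M.Λ_eq_zero, zero_mul]
      intro h
      exact hf.not_reflTransGen_of_mem_mbIn (G.mem_mbIn.2 (.inl ⟨b.2, _, hwd, h⟩)) .refl
  · intro v hvb hvS
    rw [hS, G.mem_mbIn, not_or] at hvS
    rw [hmul, hη.apply_eq_zero v hvb fun h => hvS.2 ((hD v).1 h), zero_sub, neg_eq_zero]
    refine Finset.sum_eq_zero fun w _ => ?_
    by_cases hw : η w = 0
    · rw [hw, mul_zero]
    · obtain ⟨hwA, hwd⟩ := hη0 w hw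
      rw [M.Λ_eq_zero, zero_mul]
      exact fun h => hvS.1 ⟨.head h hwA, _, hwd, h⟩
  · intro s hs
    rw [hS] at hs
    have hsA : s ∈ G.an c := by
      obtain ⟨y, -, rfl⟩ := hs
      exact y.2
    rw [hmain s hsA, M.totalEffect_eq_zero (hf.not_reflTransGen_of_mem_mbIn hs), zero_mul]

theorem Fixable.identifiedByRegression (hf : (G.induce (G.an c)).Fixable b) :
    G.IdentifiedByRegression b c (Set.toFinite (G.mbIn (G.an c) b)).toFinset := by
  have hS : ∀ x, x ∈ (Set.toFinite (G.mbIn (G.an c) b)).toFinset ↔ x ∈ G.mbIn (G.an c) b :=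
    fun x => Set.Finite.mem_toFinset _
  have hbS : (b : V) ∉ (Set.toFinite (G.mbIn (G.an c) b)).toFinset := fun h =>
    hf.not_reflTransGen_of_mem_mbIn ((hS _).1 h) .refl
  refine ⟨hbS, fun h => hf.not_reflTransGen_of_mem_mbIn ((hS _).1 h) b.2, fun M => ?_⟩
  obtain ⟨u, κ, hu, h⟩ := hf.exists_isResidual hS M
  have hpos := M.cov_posDef.mulVec_residual_pos hu
  rw [M.pathEffect_eq_totalEffect, M.cov_posDef.regCoeff_eq hbS hu, eq_div_iff hpos.ne',
    h b b.2, h c .refl, M.totalEffect_self, one_mul]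

end Fixable

end ADMG

/-! ### Necessity: no descendant of a causal child of `b` in the adjustment set -/

/-- Since `Q = -e (1 + (1 + ω) e)`, the product `X² Y²` equals `A² C² ω² Q²` but is at most `n m
Q²`, so `Q = 0`. Then `X = Y = 0`, which forces both `e = 0` and `A = 0`. -/
theorem branch_inequalities_false {A C ω e X Y Q n m : ℝ} (hA : 0 < A) (hC : 0 < C) (hω : 0 < ω)
    (hlarge : n * m < A ^ 2 * C ^ 2 * ω ^ 2) (hQ : 1 + e = (1 + e) ^ 2 + ω * e ^ 2 + Q)
    (hX : A * (1 + (1 + ω) * e) + X = 0) (hXQ : X ^ 2 ≤ n * Q)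
    (hY : C * ω * e + Y = 0) (hYQ : Y ^ 2 ≤ m * Q) : False := by
  have hQ' : Q = -e * (1 + (1 + ω) * e) := by linear_combination -hQ
  obtain rfl : X = -(A * (1 + (1 + ω) * e)) := by linarith
  obtain rfl : Y = -(C * ω * e) := by linarith
  by_cases hQ0 : Q = 0
  · rw [hQ0, mul_zero] at hXQ hYQ
    have h1 := pow_eq_zero_iff two_ne_zero |>.1 (le_antisymm hXQ (sq_nonneg _))
    have h2 := pow_eq_zero_iff two_ne_zero |>.1 (le_antisymm hYQ (sq_nonneg _))
    have h3 : e = 0 := by simpa [hC.ne', hω.ne'] using h2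
    simp [h3, hA.ne'] at h1
  · have h1 := mul_le_mul hXQ hYQ (sq_nonneg _) ((sq_nonneg _).trans hXQ)
    have h2 : (A ^ 2 * C ^ 2 * ω ^ 2 - n * m) * Q ^ 2 ≤ 0 := by
      rw [hQ'] at h1 ⊢
      linarith
    have h3 : 0 < Q ^ 2 := by positivity
    exact absurd (mul_pos (sub_pos.2 hlarge) h3) h2.not_gt

namespace ADMG

variable {V : Type*} [Fintype V] [DecidableEq V] {G : ADMG V}

open Classical in
/-- The model with unit coefficients and independent errors in which `b` has no parents and only
the child `p`, and the error of `p` has variance `ω`. -/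
noncomputable def branchModel (G : ADMG V) (b p : V) (ω : ℝ) (hω : 0 < ω) : G.LinearSEM where
  Λ x y := if G.dir x y ∧ y ≠ b ∧ (x = b → y = p) then 1 else 0
  Ω := diagonal fun v => if v = p then ω else 1
  Λ_eq_zero x y h := if_neg fun h' => h h'.1
  Ω_eq_zero x y h _ := diagonal_apply_ne _ h
  Ω_posDef := .diagonal fun v => by
    split
    · exact hω
    · exact one_pos

section BranchModel

variable {b p : V} {ω : ℝ} {hω : 0 < ω}

theorem branchModel_totalEffect_right (a : V) :
    (G.branchModel b p ω hω).totalEffect a b = (1 : Matrix V V ℝ) a b := by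
  rw [LinearSEM.totalEffect_apply', add_eq_left]
  exact Finset.sum_eq_zero fun w _ => by simp [branchModel]

theorem branchModel_totalEffect_left (hbp : G.dir b p) (v : V) :
    (G.branchModel b p ω hω).totalEffect b v =
      (1 : Matrix V V ℝ) b v + (G.branchModel b p ω hω).totalEffect p v := by
  have hpb : p ≠ b := by
    rintro rfl
    exact G.acyclic _ (.single hbp)
  rw [LinearSEM.totalEffect_apply, Finset.sum_eq_single p]
  · simp [branchModel, hbp, hpb]
  · intro w _ hw
    simp [branchModel, hw]
  · simp

/-- The edges removed in the model all touch `b`, so every directed path starting strictly below `b`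
survives with weight one. -/
theorem branchModel_totalEffect_pos {x v : V} (hbx : Relation.TransGen G.dir b x)
    (hxv : Relation.ReflTransGen G.dir x v) :
    0 < (G.branchModel b p ω hω).totalEffect x v := by
  have hΛ : ∀ x y, 0 ≤ (G.branchModel b p ω hω).Λ x y := fun x y => by
    simp only [branchModel]
    split <;> norm_num
  induction hxv using Relation.ReflTransGen.head_induction_on with
  | refl => rw [LinearSEM.totalEffect_self]; exact one_pos
  | @head x y hxy hyv ih =>
    have ne : ∀ {z}, Relation.TransGen G.dir b z → z ≠ b := by
      rintro z hz rfl
      exact G.acyclic _ hz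
    have hby := hbx.tail hxy
    rw [LinearSEM.totalEffect_apply]
    refine add_pos_of_nonneg_of_pos (by rw [one_apply]; split <;> norm_num) ?_
    refine Finset.sum_pos' (fun w _ => mul_nonneg (hΛ x w) (LinearSEM.totalEffect_nonneg _ hΛ w v))
      ⟨y, Finset.mem_univ y, ?_⟩
    have h1 : (G.branchModel b p ω hω).Λ x y = 1 :=
      if_pos ⟨hxy, ne hby, fun h => absurd h (ne hbx)⟩
    rw [h1, one_mul]
    exact ih hby

end BranchModel

/-- A valid adjustment set contains no descendant of a vertex `p ≠ b` on a directed path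
from `b` to `c`. -/
theorem IdentifiedByRegression.not_reflTransGen {b c p s : V} {S : Finset V}
    (h : G.IdentifiedByRegression b c S) (hbp : G.dir b p)
    (hpc : Relation.ReflTransGen G.dir p c) (hs : s ∈ S) :
    ¬ Relation.ReflTransGen G.dir p s := by
  intro hps
  have hpb : p ≠ b := by
    rintro rfl
    exact G.acyclic _ (.single hbp)
  have hcb : c ≠ b := by
    rintro rfl
    exact G.acyclic _ (.head' hbp hpc)
  have hsb : s ≠ b := fun e => h.1 (e ▸ hs)
  -- Total effects do not depend on `ω`, so `T` can be fixed first and `ω` chosen large in terms of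
  -- it.
  set T := (G.branchModel b p 1 one_pos).totalEffect with hT
  set R : Finset V := (Finset.univ.erase b).erase p with hR
  have hsplit : ∀ f : V → ℝ, ∑ a, f a = f b + f p + ∑ a ∈ R, f a := fun f => by
    rw [hR, add_assoc, Finset.add_sum_erase _ _ (by simp [hpb]),
      Finset.add_sum_erase _ _ (Finset.mem_univ b)]
  have hA : 0 < T p s := branchModel_totalEffect_pos (.single hbp) hps
  have hC : 0 < T p c := branchModel_totalEffect_pos (.single hbp) hpc
  set n := ∑ a ∈ R, T a s ^ 2
  set m := ∑ a ∈ R, T a c ^ 2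
  have hn : 0 ≤ n := Finset.sum_nonneg fun _ _ => sq_nonneg _
  have hm : 0 ≤ m := Finset.sum_nonneg fun _ _ => sq_nonneg _
  obtain ⟨ω, hω1, hlarge⟩ : ∃ ω : ℝ, 1 ≤ ω ∧ n * m < T p s ^ 2 * T p c ^ 2 * ω ^ 2 := by
    have hx : 0 < T p s ^ 2 * T p c ^ 2 := by positivity
    -- With `y` this quotient, `(y + 1)² > y`.
    refine ⟨n * m / (T p s ^ 2 * T p c ^ 2) + 1, ?_, ?_⟩
    · have : 0 ≤ n * m / (T p s ^ 2 * T p c ^ 2) := by positivity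
      linarith
    · set y := n * m / (T p s ^ 2 * T p c ^ 2) with hy
      have hy0 : 0 ≤ y := by positivity
      have : n * m = T p s ^ 2 * T p c ^ 2 * y := by
        rw [hy]
        field_simp
      rw [this]
      exact mul_lt_mul_of_pos_left (by nlinarith) hx
  have hω : 0 < ω := by linarith
  set M := G.branchModel b p ω hω with hM
  have hMT : M.totalEffect = T := rfl
  obtain ⟨u, hu⟩ := M.cov_posDef.exists_isResidual h.1
  set η : V → ℝ := T *ᵥ u with hη
  have hTb : ∀ v, v ≠ b → T b v = T p v := fun v hv => by
    rw [hT, branchModel_totalEffect_left hbp, one_apply_ne hv.symm, zero_add]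
  have hηb : η b = 1 + η p := by
    have h1 : ∀ v, T b v * u v = (1 : Matrix V V ℝ) b v * u v + T p v * u v := fun v => by
      rw [hT, branchModel_totalEffect_left hbp, add_mul]
    simp only [hη, mulVec, dotProduct, h1, Finset.sum_add_distrib]
    congr 1
    simp [one_apply, hu.apply_self]
  have hΩ : ∀ a, (M.Ω *ᵥ η) a = (if a = p then ω else 1) * η a := fun a => by
    simp [hM, branchModel, mulVec_diagonal]
  have hcov : ∀ v, (M.cov *ᵥ u) v = T b v * η b + T p v * (ω * η p) + ∑ a ∈ R, T a v * η a := by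
    intro v
    rw [M.cov_mulVec, hMT, ← hη, mulVec, dotProduct, hsplit]
    simp only [transpose_apply, hΩ, if_neg hpb.symm, if_true, one_mul]
    congr 1
    refine Finset.sum_congr rfl fun a ha => ?_
    rw [if_neg (Finset.ne_of_mem_erase ha), one_mul]
  have hcov_b : (M.cov *ᵥ u) b = 1 + η p := by
    have h0 : ∀ a, a ≠ b → T a b = 0 := fun a ha => by
      rw [hT, branchModel_totalEffect_right, one_apply_ne ha]
    have h1 : T b b = 1 := by rw [hT, branchModel_totalEffect_right, one_apply_eq]
    rw [hcov, h1, h0 p hpb, Finset.sum_eq_zero fun a ha => by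
      rw [h0 a (Finset.ne_of_mem_erase (Finset.mem_of_mem_erase ha)), zero_mul], hηb]
    ring
  have hcov_c := h.cov_mulVec_eq M hu
  rw [hcov, hcov_b, hMT, hηb, hTb c hcb] at hcov_c
  have hcov_s := hu.mulVec_eq_zero s hs
  rw [hcov, hηb, hTb s hsb] at hcov_s
  -- The residual variance is computed twice, from the observed covariance and from the independent
  -- errors; this yields the quadratic relation in `η p`.
  have hquad : u ⬝ᵥ (M.cov *ᵥ u) = η ⬝ᵥ (M.Ω *ᵥ η) := by
    rw [M.cov_mulVec, hMT, dotProduct_mulVec, vecMul_transpose]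
  have hquad_left : u ⬝ᵥ (M.cov *ᵥ u) = 1 + η p := by
    rw [dotProduct, Finset.sum_eq_single b, hu.apply_self, one_mul, hcov_b]
    · intro v _ hv
      by_cases hvS : v ∈ S
      · rw [hu.mulVec_eq_zero v hvS, mul_zero]
      · rw [hu.apply_eq_zero v hv hvS, zero_mul]
    · simp
  have hquad_right : η ⬝ᵥ (M.Ω *ᵥ η) = (1 + η p) ^ 2 + ω * η p ^ 2 + ∑ a ∈ R, η a ^ 2 := by
    rw [dotProduct, hsplit]
    simp only [hΩ, if_neg hpb.symm, if_true, one_mul, hηb]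
    congr 1
    · ring
    · refine Finset.sum_congr rfl fun a ha => ?_
      rw [if_neg (Finset.ne_of_mem_erase ha)]
      ring
  refine branch_inequalities_false (e := η p) hA hC hω hlarge
    (hquad_left.symm.trans (hquad.trans hquad_right)) (X := ∑ a ∈ R, T a s * η a)
    (Y := ∑ a ∈ R, T a c * η a) ?_ (Finset.sum_mul_sq_le_sq_mul_sq _ _ _) ?_
    (Finset.sum_mul_sq_le_sq_mul_sq _ _ _)
  · linear_combination hcov_s
  · linear_combination hcov_c

end ADMG

/-! ### Necessity: no bidirected connection to a descendant -/

/-- Zeros propagate backwards from `c`: once `u` vanishes on the tail starting at `a'`, the equation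
at `a'` retains only the term of its predecessor `a`. -/
theorem SimpleGraph.Walk.IsPath.eq_zero_of_sum_eq_zero {V : Type*} [Fintype V] [DecidableEq V]
    {Q : SimpleGraph V} {a c : V} {p : Q.Walk a c} (hp : p.IsPath) {B : V → V → ℝ} {u : V → ℝ}
    (huc : u c = 0) (hsum : ∀ v ∈ p.support, v ≠ a → ∑ r, B v r * u r = 0)
    (hzero : ∀ v ∈ p.support, v ≠ a → ∀ r, r ≠ v → s(v, r) ∉ p.edges → B v r * u r = 0)
    (hne : ∀ v r, s(v, r) ∈ p.edges → B v r ≠ 0) : ∀ v ∈ p.support, u v = 0 := by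
  induction p with
  | nil => simpa using huc
  | @cons a a' c h q ih =>
    rw [SimpleGraph.Walk.cons_isPath_iff] at hp
    have hqa : ∀ {v}, v ∈ q.support → v ≠ a := fun hv e => hp.2 (e ▸ hv)
    have ha' : a' ∈ q.support := q.start_mem_support
    have hq : ∀ v ∈ q.support, u v = 0 := by
      refine ih hp.1 huc (fun v hv _ => hsum v (by simp [hv]) (hqa hv)) ?_
        fun v r hvr => hne v r (by simp [hvr])
      intro v hv hva' r hr hvr
      refine hzero v (by simp [hv]) (hqa hv) r hr ?_
      rw [SimpleGraph.Walk.edges_cons, List.mem_cons, not_or]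
      refine ⟨fun e => ?_, hvr⟩
      rcases Sym2.eq_iff.1 e with ⟨e, -⟩ | ⟨e, -⟩
      · exact hqa hv e
      · exact hva' e
    have h1 := hsum a' (by simp [ha']) (hqa ha')
    rw [Finset.sum_eq_single a] at h1
    · have h2 := (mul_eq_zero.1 h1).resolve_left
        (hne a' a (by simp [Sym2.eq_swap]))
      intro v hv
      rw [SimpleGraph.Walk.support_cons, List.mem_cons] at hv
      rcases hv with rfl | hv
      · exact h2
      · exact hq v hv
    · intro r _ hr
      by_cases hrq : r ∈ q.support
      · rw [hq r hrq, mul_zero]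
      · refine hzero a' (by simp [ha']) (hqa ha') r (fun e => hrq (e ▸ ha')) ?_
        rw [SimpleGraph.Walk.edges_cons, List.mem_cons, not_or]
        refine ⟨fun e => ?_, fun e => hrq (q.snd_mem_support_of_mem_edges e)⟩
        rcases Sym2.eq_iff.1 e with ⟨e, -⟩ | ⟨-, e⟩
        · exact hqa ha' e
        · exact hr e
    · simp

/-- By the arithmetic-geometric mean inequality the quadratic form of `A` is at least `-card V *
‖x‖²`, which the diagonal outweighs. -/
theorem Matrix.posDef_card_smul_one_add {V : Type*} [Fintype V] [DecidableEq V]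
    {A : Matrix V V ℝ} (hA : A.IsSymm) (h1 : ∀ x y, |A x y| ≤ 1) :
    (((Fintype.card V : ℝ) + 1) • (1 : Matrix V V ℝ) + A).PosDef := by
  refine PosDef.of_dotProduct_mulVec_pos ?_ fun {x} hx => ?_
  · rw [IsHermitian, conjTranspose_eq_transpose_of_trivial, transpose_add, transpose_smul,
      transpose_one, hA.eq]
  · obtain ⟨i, hi⟩ := Function.ne_iff.1 hx
    have hpos : 0 < ∑ v, x v ^ 2 :=
      Finset.sum_pos' (fun v _ => sq_nonneg _) ⟨i, Finset.mem_univ i, by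
        have : x i ≠ 0 := hi
        positivity⟩
    have hle : -((Fintype.card V : ℝ) * ∑ v, x v ^ 2) ≤ x ⬝ᵥ (A *ᵥ x) := by
      have h2 : ∀ v w, -((x v ^ 2 + x w ^ 2) / 2) ≤ x v * (A v w * x w) := fun v w => by
        have h3 : |x v * (A v w * x w)| ≤ (x v ^ 2 + x w ^ 2) / 2 := by
          rw [abs_mul, abs_mul]
          have h4 : |x v| * (|A v w| * |x w|) ≤ |x v| * |x w| :=
            mul_le_mul_of_nonneg_left (mul_le_of_le_one_left (abs_nonneg _) (h1 v w))
              (abs_nonneg _)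
          nlinarith [sq_nonneg (|x v| - |x w|), sq_abs (x v), sq_abs (x w)]
        exact (abs_le.1 h3).1
      have h5 : -((Fintype.card V : ℝ) * ∑ v, x v ^ 2) =
          ∑ v, ∑ w, -((x v ^ 2 + x w ^ 2) / 2) := by
        simp only [Finset.sum_neg_distrib, ← Finset.sum_div, Finset.sum_add_distrib,
          Finset.sum_const, Finset.card_univ, nsmul_eq_mul, ← Finset.mul_sum]
        ring
      rw [h5]
      simp only [dotProduct, mulVec, Finset.mul_sum]
      exact Finset.sum_le_sum fun v _ => Finset.sum_le_sum fun w _ => h2 v w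
    have h6 : x ⬝ᵥ x = ∑ v, x v ^ 2 := Finset.sum_congr rfl fun v _ => (sq (x v)).symm
    rw [star_trivial, add_mulVec, smul_mulVec, one_mulVec, dotProduct_add, dotProduct_smul, h6,
      smul_eq_mul]
    linarith

namespace ADMG

variable {V : Type*} [Fintype V] [DecidableEq V] {G : ADMG V}

/-- There are edge coefficients for which the error of every ancestor `v` of `c` flows undivided
to a single vertex `label v` of `R`, and no effect passes through a vertex of `R`. -/
theorem exists_flow (G : ADMG V) {c : V} {R : Set V} (hcR : c ∈ R) :
    ∃ (Λ : Matrix V V ℝ) (label : V → V), (∀ x y, ¬ G.dir x y → Λ x y = 0) ∧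
      (∀ v, Relation.ReflTransGen G.dir v (label v)) ∧ (∀ v ∈ G.an c, label v ∈ R) ∧
      ∀ M : G.LinearSEM, M.Λ = Λ → ∀ v, ∀ r ∈ R,
        M.totalEffect v r = (1 : Matrix V V ℝ) (label v) r := by
  classical
  -- As `c ∈ R`, an ancestor of `c` outside `R` has a child that is again an ancestor of `c`; all
  -- its effect is sent through one such child, and vertices of `R` send nothing on.
  have hnext : ∀ v, ∃ w, v ∈ G.an c → v ∉ R → G.dir v w ∧ w ∈ G.an c := by
    intro v
    by_cases h : v ∈ G.an c ∧ v ∉ R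
    · rcases Relation.ReflTransGen.cases_head h.1 with e | ⟨w, hw⟩
      · exact absurd (e ▸ hcR) h.2
      · exact ⟨w, fun _ _ => hw⟩
    · exact ⟨v, fun h1 h2 => absurd ⟨h1, h2⟩ h⟩
  choose next hnext using hnext
  let M₀ : G.LinearSEM :=
    { Λ := fun x y => if x ∈ G.an c ∧ x ∉ R ∧ y = next x then 1 else 0
      Ω := 1
      Λ_eq_zero := fun x y h => if_neg <| by
        rintro ⟨h1, h2, rfl⟩
        exact h (hnext x h1 h2).1
      Ω_eq_zero := fun x y h _ => one_apply_ne h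
      Ω_posDef := .one }
  have hterminal : ∀ v, (v ∈ G.an c → v ∈ R) → ∀ r,
      M₀.totalEffect v r = (1 : Matrix V V ℝ) v r := by
    intro v hv r
    rw [M₀.totalEffect_apply, add_eq_left]
    refine Finset.sum_eq_zero fun w _ => ?_
    have : M₀.Λ v w = 0 := if_neg fun h => h.2.1 (hv h.1)
    rw [this, zero_mul]
  have hlabel : ∀ v, ∃ l, Relation.ReflTransGen G.dir v l ∧ (v ∈ G.an c → l ∈ R) ∧
      ∀ r ∈ R, M₀.totalEffect v r = (1 : Matrix V V ℝ) l r := by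
    intro v
    induction v using G.wellFounded_swap_dir.induction with
    | _ v ih =>
      by_cases hv : v ∈ G.an c → v ∈ R
      · exact ⟨v, .refl, hv, fun r _ => hterminal v hv r⟩
      · rw [Classical.not_imp] at hv
        obtain ⟨h1, h2⟩ := hnext v hv.1 hv.2
        obtain ⟨l, hl1, hl2, hl3⟩ := ih (next v) h1
        refine ⟨l, .head h1 hl1, fun _ => hl2 h2, fun r hr => ?_⟩
        have hvr : v ≠ r := fun e => hv.2 (e ▸ hr)
        rw [M₀.totalEffect_apply, one_apply_ne hvr, zero_add, Finset.sum_eq_single (next v),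
          ← hl3 r hr]
        · have : M₀.Λ v (next v) = 1 := if_pos ⟨hv.1, hv.2, rfl⟩
          rw [this, one_mul]
        · intro w _ hw
          have : M₀.Λ v w = 0 := if_neg fun h => hw h.2.2
          rw [this, zero_mul]
        · simp
  choose label hl1 hl2 hl3 using hlabel
  refine ⟨M₀.Λ, label, M₀.Λ_eq_zero, hl1, hl2, fun M hM v r hr => ?_⟩
  rw [← hl3 v r hr, LinearSEM.totalEffect, hM, LinearSEM.totalEffect]

/-- The flow model turns bidirected edges into covariances between labels. Switching on only those
that lie over one path from `b` to `c` makes the regression equations solvable step by step from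
`c`, where `u c = 0`. -/
theorem IdentifiedByRegression.false_of_bidirected_path {b c : V} {S : Finset V}
    (h : G.IdentifiedByRegression b c S) (hcb : c ≠ b) {b' d : G.an c} (hb' : (b' : V) = b)
    (hd : (G.induce (G.an c)).bi.Reachable b' d) (hdb : ¬ Relation.ReflTransGen G.dir d b)
    (hdS : ∀ s ∈ S, ¬ Relation.ReflTransGen G.dir d s) : False := by
  classical
  set R : Set V := {v | v = b ∨ v = c ∨ v ∈ S} with hR
  obtain ⟨Λ, label, hΛ, hreach, hlabelR, hT⟩ := G.exists_flow (c := c) (R := R) (by simp [hR])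
  -- The diagonal entry `T r r = 1`, read in the model with identity error covariance, forces the
  -- label.
  have hself : ∀ r ∈ R, label r = r := by
    intro r hr
    by_contra hne
    have h1 := hT ⟨Λ, 1, hΛ, fun x y h _ => one_apply_ne h, .one⟩ rfl r r hr
    rw [LinearSEM.totalEffect_self, one_apply_ne hne] at h1
    exact one_ne_zero h1
  have hlb : label b = b := hself b (by simp [hR])
  have hld : label d = c := by
    have h1 := hreach d
    rcases hlabelR d d.2 with e | e | e
    · exact absurd (e ▸ h1) hdb
    · exact e
    · exact absurd h1 (hdS _ e)
  -- The image under `label` of the bidirected graph on `an(c)`, with loops discarded.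
  let Q : SimpleGraph V :=
    { Adj := fun r r' => r ≠ r' ∧
        ∃ x ∈ G.an c, ∃ y ∈ G.an c, G.bi.Adj x y ∧ label x = r ∧ label y = r'
      symm := ⟨fun r r' ⟨hne, x, hx, y, hy, hxy, h1, h2⟩ =>
        ⟨hne.symm, y, hy, x, hx, hxy.symm, h2, h1⟩⟩
      loopless := ⟨fun r hr => hr.1 rfl⟩ }
  have hreachQ : Q.Reachable b c := by
    have : ∀ {x y : G.an c}, (G.induce (G.an c)).bi.Walk x y →
        Q.Reachable (label x) (label y) := by
      intro x y w
      induction w with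
      | nil => exact SimpleGraph.Reachable.refl _
      | @cons x y z hxy _ ih =>
        by_cases e : label x = label y
        · exact e ▸ ih
        · exact SimpleGraph.Reachable.trans
            (SimpleGraph.Adj.reachable ⟨e, x, x.2, y, y.2, hxy, rfl, rfl⟩) ih
    obtain ⟨w⟩ := hd
    have := this w
    rwa [hb', hlb, hld] at this
  obtain ⟨p, hp⟩ := hreachQ.exists_isPath
  have hpR : ∀ v ∈ p.support, v ∈ R := by
    have : ∀ {x y : V} (w : Q.Walk x y), x ∈ R → ∀ v ∈ w.support, v ∈ R := by
      intro x y w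
      induction w with
      | nil =>
        intro hx v hv
        rw [SimpleGraph.Walk.support_nil, List.mem_singleton] at hv
        exact hv ▸ hx
      | cons hxy w ih =>
        intro hx v hv
        rw [SimpleGraph.Walk.support_cons, List.mem_cons] at hv
        rcases hv with rfl | hv
        · exact hx
        · obtain ⟨-, -, -, y, hy, -, -, e⟩ := hxy
          exact ih (e ▸ hlabelR y hy) v hv
    exact this p (by simp [hR])
  -- Only bidirected edges over edges of `p` get nonzero covariance. Nonnegative entries rule out
  -- cancellation when several lie over the same edge.
  let A : Matrix V V ℝ := fun x y => if G.bi.Adj x y ∧ x ∈ G.an c ∧ y ∈ G.an c ∧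
    s(label x, label y) ∈ p.edges then 1 else 0
  have hA0 : ∀ x y, 0 ≤ A x y := fun x y => by
    simp only [A]
    split <;> norm_num
  have hAsymm : A.IsSymm := by
    ext x y
    simp only [A]
    refine if_congr ?_ rfl rfl
    rw [G.bi.adj_comm, Sym2.eq_swap]
    tauto
  have hPD := posDef_card_smul_one_add hAsymm fun x y => by
    simp only [A]
    split <;> norm_num
  let M : G.LinearSEM :=
    { Λ := Λ
      Ω := ((Fintype.card V : ℝ) + 1) • (1 : Matrix V V ℝ) + A
      Λ_eq_zero := hΛ
      Ω_eq_zero := fun x y hne hxy => by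
        rw [Matrix.add_apply, Matrix.smul_apply, one_apply_ne hne, smul_zero, zero_add]
        exact if_neg fun h => hxy h.1
      Ω_posDef := hPD }
  have hMT : ∀ v, ∀ r ∈ R, M.totalEffect v r = (1 : Matrix V V ℝ) (label v) r := hT M rfl
  have hcov : ∀ r ∈ R, ∀ r' ∈ R, r ≠ r' → M.cov r r' =
      ∑ y, ∑ x, if label x = r ∧ label y = r' then A x y else 0 := by
    intro r hr r' hr' hne
    simp only [M.cov_eq, mul_apply, transpose_apply, Finset.sum_mul]
    refine Finset.sum_congr rfl fun y _ => Finset.sum_congr rfl fun x _ => ?_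
    rw [hMT x r hr, hMT y r' hr', one_apply, one_apply]
    by_cases h1 : label x = r
    · by_cases h2 : label y = r'
      · have hxy : x ≠ y := fun e => hne (h1 ▸ h2 ▸ congrArg label e)
        simp [h1, h2, M, hxy]
      · simp [h2]
    · simp [h1]
  obtain ⟨u, hu⟩ := M.cov_posDef.exists_isResidual h.1
  have hu0 : u b = 0 := by
    refine hp.eq_zero_of_sum_eq_zero (B := M.cov) (u := u)
      (hu.apply_eq_zero c hcb h.2.1) ?_ ?_ ?_ b p.start_mem_support
    · intro v hv hvb
      change (M.cov *ᵥ u) v = 0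
      rcases hpR v hv with e | rfl | hvS
      · exact absurd e hvb
      -- At `c` the equation comes from identification: the error of `b` stays at `b`, so the effect
      -- on `c` is zero.
      · rw [h.cov_mulVec_eq M hu, hMT b v (by simp [hR]), hlb, one_apply_ne hcb.symm, zero_mul]
      · exact hu.mulVec_eq_zero v hvS
    · intro v hv hvb r hrv hvr
      by_cases hrR : r ∈ R
      · rw [hcov v (hpR v hv) r hrR hrv.symm, Finset.sum_eq_zero, zero_mul]
        refine fun y _ => Finset.sum_eq_zero fun x _ => ?_
        split_ifs with hxy
        · refine if_neg fun h' => hvr ?_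
          rw [← hxy.1, ← hxy.2]
          exact h'.2.2.2
        · rfl
      · rw [hu.apply_eq_zero r (fun e => hrR (.inl e)) fun e => hrR (.inr (.inr e)), mul_zero]
    · intro v r hvr
      have hadj : Q.Adj v r := p.adj_of_mem_edges hvr
      rw [hcov v (hpR v (p.fst_mem_support_of_mem_edges hvr)) r
        (hpR r (p.snd_mem_support_of_mem_edges hvr)) hadj.1]
      obtain ⟨-, x, hx, y, hy, hxy, rfl, rfl⟩ := hadj
      have hnn : ∀ x' y', 0 ≤ if label x' = label x ∧ label y' = label y then A x' y' else 0 :=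
        fun x' y' => by
          split
          · exact hA0 _ _
          · exact le_rfl
      refine (Finset.sum_pos' (fun y' _ => Finset.sum_nonneg fun x' _ => hnn x' y')
        ⟨y, Finset.mem_univ y, Finset.sum_pos' (fun x' _ => hnn x' y)
          ⟨x, Finset.mem_univ x, ?_⟩⟩).ne'
      have : A x y = 1 := if_pos ⟨hxy, hx, hy, hvr⟩
      simp [this]
  rw [hu.apply_self] at hu0
  exact one_ne_zero hu0

end ADMG

/-! ### The equivalence -/

namespace ADMG

variable {V : Type*} [Fintype V] [DecidableEq V] {G : ADMG V}

/-- For a violating `d`, take the first edge `b → p` of a directed path to `d`. Descendants of `d`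
are descendants of `p`, hence outside `S`, and acyclicity prevents `d` from reaching `b`. -/
theorem IdentifiedByRegression.fixable {b c : V} {S : Finset V}
    (h : G.IdentifiedByRegression b c S) (hcb : c ≠ b) (hb : b ∈ G.an c) :
    (G.induce (G.an c)).Fixable ⟨b, hb⟩ := by
  refine Set.Subset.antisymm ?_ ?_
  · rintro d ⟨hde, hdis⟩
    by_contra hne
    have hbd : Relation.ReflTransGen G.dir b d := (G.mem_de_induce_an ⟨b, hb⟩ d).1 hde
    rcases Relation.ReflTransGen.cases_head hbd with e | ⟨p, hbp, hpd⟩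
    · exact hne (Subtype.ext e.symm)
    · exact h.false_of_bidirected_path hcb rfl hdis
        (fun hdb => G.acyclic b (.head' hbp (hpd.trans hdb)))
        fun s hs hds => h.not_reflTransGen hbp (hpd.trans d.2) hs (hpd.trans hds)
  · rintro _ rfl
    exact ⟨.refl, SimpleGraph.Reachable.refl _⟩

end ADMG

theorem mainTheorem2 {V : Type*} [Fintype V] [DecidableEq V] (G : ADMG V) (b c : V)
    (hc : c ∈ G.de b) (hcb : c ≠ b) :
    (G.RegressionIdentifiable b c ↔
      (G.induce (G.an c)).Fixable ⟨b, G.mem_an_of_mem_de hc⟩) ∧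
    ((G.induce (G.an c)).Fixable ⟨b, G.mem_an_of_mem_de hc⟩ →
      G.IdentifiedByRegression b c
        (Set.toFinite (G.mbIn (G.an c) ⟨b, G.mem_an_of_mem_de hc⟩)).toFinset) :=
  ⟨⟨fun ⟨_, hS⟩ => hS.fixable hcb _, fun hf => ⟨_, hf.identifiedByRegression⟩⟩,
    fun hf => hf.identifiedByRegression⟩
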